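/- Let $\mathbb H$ be an infinite-dimensional separable complex Hilbert space (inner product linear in the second variable) and let $\mathbb K$ be a positive-definite trace class operator on $\mathbb H$, the covariance operator of a centered Gaussian measure $\mu$. Let $\mathbb H_\mu=\operatorname{ran}\mathbb K^{1/2}$ be its Cameron–Martin Hilbert space, with inner product $\langle\xi,\eta\rangle_{\mathbb H_\mu}=\langle\mathbb K^{-1/2}\xi,\mathbb K^{-1/2}\eta\rangle$ (also written $\langle\xi,\mathbb K^{-1}\eta\rangle$), and let $\mathbb B$ and $\bar{\mathbb B}$ be its open and closed unit balls. Let $\mathcal C^W$ be the set of power series $\Lambda(z)=\sum_{n\ge0}\lambda_nz^n$ with $\lambda_n\ge0$ for all $n$ and $\sum_n\lambda_n<\infty$; call $\Lambda\in\mathcal C^W$ essential if there is $C>0$ with $C\Lambda-\Lambda^2\in\mathcal C^W$. Let $\Lambda\in\mathcal C^W$. Then the kernel $\mathcal K_\Lambda(\xi,\eta)=\Lambda(\langle\xi,\mathbb K^{-1}\eta\rangle)$ on $\bar{\mathbb B}\times\bar{\mathbb B}$ is positive semidefinite, so it is the reproducing kernel of a reproducing kernel Hilbert space $\mathcal A_\Lambda$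 of complex-valued functions on $\bar{\mathbb B}$ (with kernel sections $\mathcal K_\Lambda(\xi,\cdot)\in\mathcal A_\Lambda$), and: (a) every $f\in\mathcal A_\Lambda$ is holomorphic on the open set $\mathbb B\subset\mathbb H_\mu$, i.e. around each point of $\mathbb B$ it is given by a convergent power series of continuous homogeneous polynomials on $\mathbb H_\mu$; (b) $\mathcal A_\Lambda$ is invariant under the unitary group of $\mathbb H_\mu$: for every unitary operator $U$ of $\mathbb H_\mu$ and $f\in\mathcal A_\Lambda$, the function $f\circ U$ belongs to $\mathcal A_\Lambda$ and $\|f\circ U\|=\|f\|$; (c) if $\Lambda$ is essential, then $\mathcal A_\Lambda$ is a reproducing kernel Hilbert algebra, i.e. there is a bounded operator $\Delta\colon\mathcal A_\Lambda\to\mathcal A_\Lambda\otimes\mathcal A_\Lambda$ (Hilbert space tensor product) with $\Delta\mathcal K_\Lambda(\xi,\cdot)=\mathcal K_\Lambda(\xi,\cdot)\otimes\mathcal K_\Lambda(\xi,\cdot)$ for all $\xi\in\bar{\mathbb B}$, and $\mathcal A_\Lambda$ is closed under pointwise multiplication; if moreover $\lambda_0>0$, then it is unital, i.e. it contains the constant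 function $1$. -/

import Mathlib

universe u

open scoped InnerProductSpace TensorProduct PowerSeries ComplexOrder

noncomputable section

/-! ### The positive cone of the Wiener algebra -/

/-- The holomorphic part of the Wiener algebra: power series with absolutely summable
coefficients. The product is that of power series. -/
def WienerAlgebra : Set ℂ⟦X⟧ :=
  {a | Summable fun n => ‖PowerSeries.coeff n a‖}

/-- The positive cone of the Wiener algebra: all coefficients are nonnegative reals. -/
def WienerCone : Set ℂ⟦X⟧ :=
  {a | a ∈ WienerAlgebra ∧ ∀ n, 0 ≤ PowerSeries.coeff n a}

/-- The order on the Wiener algebra induced by the positive cone. -/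
def WienerLE (a b : ℂ⟦X⟧) : Prop :=
  b - a ∈ WienerCone

/-- `a` is an essential element of the positive cone: `a ^ 2 ≤ C a` for some `C > 0`. -/
def IsEssential (a : ℂ⟦X⟧) : Prop :=
  a ∈ WienerCone ∧ ∃ C : ℝ, 0 < C ∧ WienerLE (a ^ 2) ((C : ℂ) • a)

/-- The value `∑ aₙ zⁿ` of an element of the Wiener algebra at `z`, `‖z‖ ≤ 1`. -/
def wienerEval (a : ℂ⟦X⟧) (z : ℂ) : ℂ :=
  ∑' n, PowerSeries.coeff n a * z ^ n

/-! ### The Cameron–Martin space of a positive definite trace class operator -/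

variable {H : Type*} [NormedAddCommGroup H] [InnerProductSpace ℂ H] [CompleteSpace H]

/-- `T` is a positive definite trace class operator: `T` is positive (hence self-adjoint),
`⟪T x, x⟫ > 0` for `x ≠ 0`, and the trace is finite in some (equivalently, every)
orthonormal basis. -/
structure IsPosDefTraceClass (T : H →L[ℂ] H) : Prop where
  isPositive : T.IsPositive
  definite : ∀ x, x ≠ 0 → 0 < RCLike.re ⟪T x, x⟫_ℂ
  finite_trace : ∃ e : HilbertBasis ℕ ℂ H, Summable fun n => RCLike.re ⟪T (e n), e n⟫_ℂ

variable (H) in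
/-- A positive definite trace class operator, the covariance operator of a nondegenerate
centered Gaussian measure on `H`. -/
structure CovarianceOperator where
  op : H →L[ℂ] H
  isPosDefTraceClass : IsPosDefTraceClass op

namespace CovarianceOperator

variable (K : CovarianceOperator H)

/-- The square root `K^{1/2}`. -/
def sqrt : H →L[ℂ] H := CFC.sqrt K.op

theorem sqrt_sqrt (x : H) : K.sqrt (K.sqrt x) = K.op x := by
  have h : CFC.sqrt K.op * CFC.sqrt K.op = K.op :=
    CFC.sqrt_mul_sqrt_self K.op
      ((ContinuousLinearMap.nonneg_iff_isPositive _).2 K.isPosDefTraceClass.isPositive)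
  exact congrArg (fun T : H →L[ℂ] H => T x) h

theorem sqrt_isPositive : K.sqrt.IsPositive :=
  (ContinuousLinearMap.nonneg_iff_isPositive _).1 (CFC.sqrt_nonneg K.op)

theorem sqrt_injective : Function.Injective K.sqrt := by
  refine (injective_iff_map_eq_zero K.sqrt).2 fun x hx => ?_
  by_contra h
  have h1 := K.isPosDefTraceClass.definite x h
  rw [← K.sqrt_sqrt, hx] at h1
  simp at h1

/-- The Cameron–Martin space `{ξ : ‖K^{-1/2} ξ‖ < ∞}`, that is, the range of `K^{1/2}`. -/
def CameronMartin : Type _ := LinearMap.range (K.sqrt : H →ₗ[ℂ] H)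

instance : AddCommGroup K.CameronMartin :=
  inferInstanceAs (AddCommGroup (LinearMap.range (K.sqrt : H →ₗ[ℂ] H)))

instance : Module ℂ K.CameronMartin :=
  inferInstanceAs (Module ℂ (LinearMap.range (K.sqrt : H →ₗ[ℂ] H)))

/-- The inclusion of the Cameron–Martin space into `H`. -/
def incl : K.CameronMartin →ₗ[ℂ] H := (LinearMap.range (K.sqrt : H →ₗ[ℂ] H)).subtype

/-- `K^{1/2}` as a linear bijection from `H` onto the Cameron–Martin space. -/
def sqrtEquiv : H ≃ₗ[ℂ] K.CameronMartin :=
  LinearEquiv.ofInjective (K.sqrt : H →ₗ[ℂ] H) K.sqrt_injective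

/-- `K^{-1/2}`, defined on the Cameron–Martin space. -/
def invSqrt : K.CameronMartin →ₗ[ℂ] H := K.sqrtEquiv.symm

theorem incl_sqrtEquiv (x : H) : K.incl (K.sqrtEquiv x) = K.sqrt x := rfl

theorem invSqrt_sqrtEquiv (x : H) : K.invSqrt (K.sqrtEquiv x) = x :=
  K.sqrtEquiv.symm_apply_apply x

theorem sqrt_invSqrt (ξ : K.CameronMartin) : K.sqrt (K.invSqrt ξ) = K.incl ξ :=
  congrArg K.incl (K.sqrtEquiv.apply_symm_apply ξ)

/-- The Cameron–Martin norm `‖ξ‖ = ‖K^{-1/2} ξ‖`. -/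
instance : NormedAddCommGroup K.CameronMartin :=
  NormedAddCommGroup.induced K.CameronMartin H K.invSqrt K.sqrtEquiv.symm.injective

theorem norm_def (ξ : K.CameronMartin) : ‖ξ‖ = ‖K.invSqrt ξ‖ := rfl

/-- The Cameron–Martin inner product `⟪ξ, η⟫ = ⟪K^{-1/2} ξ, K^{-1/2} η⟫`
(linear in the second variable). -/
instance : InnerProductSpace ℂ K.CameronMartin where
  inner ξ η := ⟪K.invSqrt ξ, K.invSqrt η⟫_ℂ
  norm_smul_le c ξ := by simp [norm_def, norm_smul]
  norm_sq_eq_re_inner ξ := by rw [norm_def, ← norm_sq_eq_re_inner]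
  conj_inner_symm ξ η := inner_conj_symm _ _
  add_left ξ η ζ := by rw [map_add, inner_add_left]
  smul_left ξ η c := by rw [map_smul, inner_smul_left]

theorem inner_def (ξ η : K.CameronMartin) : ⟪ξ, η⟫_ℂ = ⟪K.invSqrt ξ, K.invSqrt η⟫_ℂ := rfl

/-- `K^{1/2}` is a unitary map from `H` onto the Cameron–Martin space. -/
def sqrtIsometry : H ≃ₗᵢ[ℂ] K.CameronMartin :=
  { K.sqrtEquiv with
    norm_map' := fun x => congrArg norm (K.invSqrt_sqrtEquiv x) }

instance : CompleteSpace K.CameronMartin :=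
  (completeSpace_congr (e := K.sqrtIsometry.toEquiv)
    K.sqrtIsometry.isometry.isUniformEmbedding).1 inferInstance

/-- The inner product of the Cameron–Martin space is `⟪ξ, K⁻¹ η⟫`: if `η = K ζ`, then it is
`⟪ξ, ζ⟫` in `H`. -/
theorem inner_eq_of_op_eq (ξ η : K.CameronMartin) (ζ : H) (h : K.op ζ = K.incl η) :
    ⟪ξ, η⟫_ℂ = ⟪K.incl ξ, ζ⟫_ℂ := by
  have h1 : K.invSqrt η = K.sqrt ζ := K.sqrt_injective (by rw [sqrt_invSqrt, sqrt_sqrt, h])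
  rw [inner_def, h1, ← sqrt_invSqrt]
  exact (K.sqrt_isPositive.inner_left_eq_inner_right _ _).symm

/-- The open unit ball `𝔹` of the Cameron–Martin space. -/
abbrev openBall : Set K.CameronMartin := Metric.ball 0 1

/-- The closed unit ball `𝔹̄` of the Cameron–Martin space. -/
abbrev closedBall : Set K.CameronMartin := Metric.closedBall 0 1

/-- The closed unit ball of the Cameron–Martin space is the closure of `𝔹` in `H`. -/
theorem incl_closedBall : K.incl '' K.closedBall = closure (K.incl '' K.openBall) := by
  refine Set.Subset.antisymm ?_ fun x hx => ?_
  · have hc : Continuous K.incl := by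
      have h : (K.incl : K.CameronMartin → H) = fun ξ => K.sqrt (K.sqrtIsometry.symm ξ) :=
        funext fun ξ => (K.sqrt_invSqrt ξ).symm
      rw [h]
      fun_prop
    rw [closedBall, openBall, ← closure_ball (0 : K.CameronMartin) one_ne_zero]
    exact image_closure_subset_closure_image hc
  · let T : Submodule ℂ H := LinearMap.range (K.sqrt : H →ₗ[ℂ] H)
    have hb : ∀ v : H, ‖⟪x, v⟫_ℂ‖ ≤ ‖K.sqrt v‖ := by
      intro v
      have hcl : IsClosed {y : H | ‖⟪y, v⟫_ℂ‖ ≤ ‖K.sqrt v‖} :=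
        isClosed_le (by fun_prop) continuous_const
      refine closure_minimal ?_ hcl hx
      rintro _ ⟨ξ, hξ, rfl⟩
      have h1 : ⟪K.incl ξ, v⟫_ℂ = ⟪K.invSqrt ξ, K.sqrt v⟫_ℂ := by
        rw [← K.sqrt_invSqrt]
        exact K.sqrt_isPositive.inner_left_eq_inner_right _ _
      have h2 : ‖K.invSqrt ξ‖ ≤ 1 := (mem_ball_zero_iff.1 hξ).le
      show ‖⟪K.incl ξ, v⟫_ℂ‖ ≤ _
      rw [h1]
      calc _ ≤ ‖K.invSqrt ξ‖ * ‖K.sqrt v‖ := norm_inner_le_norm _ _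
        _ ≤ 1 * ‖K.sqrt v‖ := by gcongr
        _ = _ := one_mul _
    let φ₀ : T →ₗ[ℂ] ℂ := (innerSL ℂ x : H →ₗ[ℂ] ℂ) ∘ₗ K.invSqrt
    have hφ₀ : ∀ y : T, ‖φ₀ y‖ ≤ 1 * ‖y‖ := by
      intro y
      have h3 : K.sqrt (K.invSqrt y) = (y : H) := K.sqrt_invSqrt y
      rw [one_mul, Submodule.coe_norm, ← h3]
      exact hb _
    obtain ⟨φ, hφ, hn⟩ := exists_extension_norm_eq T (φ₀.mkContinuous 1 hφ₀)
    let u : H := (InnerProductSpace.toDual ℂ H).symm φ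
    have hu : ‖u‖ ≤ 1 := by
      have h4 : ‖u‖ = ‖φ‖ := LinearIsometryEquiv.norm_map _ _
      rw [h4, hn]
      exact LinearMap.mkContinuous_norm_le _ zero_le_one _
    refine ⟨K.sqrtEquiv u, ?_, ?_⟩
    · rw [mem_closedBall_zero_iff, norm_def, invSqrt_sqrtEquiv]
      exact hu
    · rw [incl_sqrtEquiv]
      refine ext_inner_right ℂ fun v => ?_
      have h5 : ⟪K.sqrt u, v⟫_ℂ = ⟪u, K.sqrt v⟫_ℂ :=
        K.sqrt_isPositive.inner_left_eq_inner_right _ _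
      have h6 : φ (K.sqrt v) = φ₀ (K.sqrtEquiv v) := hφ (K.sqrtEquiv v)
      rw [h5, InnerProductSpace.toDual_symm_apply, h6]
      exact congrArg (fun z => ⟪x, z⟫_ℂ) (K.invSqrt_sqrtEquiv v)

/-! ### The kernel -/

/-- The kernel `𝒦(ξ, η) = Λ(⟪ξ, K⁻¹ η⟫)` on the closed Cameron–Martin unit ball. -/
def kernelFun (Λ : ℂ⟦X⟧) (ξ η : K.closedBall) : ℂ :=
  wienerEval Λ ⟪(ξ : K.CameronMartin), (η : K.CameronMartin)⟫_ℂ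

/-- The kernel in the form used for reproducing kernel Hilbert spaces, where scalars are
operators on `ℂ` and the entry at `(η, ξ)` is the value at `η` of the section `𝒦(ξ, ·)`. -/
def kernelMatrix (Λ : ℂ⟦X⟧) : Matrix K.closedBall K.closedBall (ℂ →L[ℂ] ℂ) :=
  Matrix.of fun η ξ => K.kernelFun Λ ξ η • ContinuousLinearMap.id ℂ ℂ

/-- The action of a unitary operator of the Cameron–Martin space on its closed unit ball. -/
def ballMap (U : K.CameronMartin ≃ₗᵢ[ℂ] K.CameronMartin) (ξ : K.closedBall) : K.closedBall :=
  ⟨U ξ, by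
    rw [mem_closedBall_zero_iff, U.norm_map]
    exact mem_closedBall_zero_iff.1 ξ.2⟩

end CovarianceOperator

/-! ### Reproducing kernel Hilbert algebras -/

section RKHA

variable {X : Type*} (A : Type*) [NormedAddCommGroup A] [InnerProductSpace ℂ A] [CompleteSpace A]
  [RKHS ℂ A X ℂ]

/-- The Hilbert space tensor product `A ⊗ A`. -/
abbrev HilbertTensorSquare (A : Type*) [NormedAddCommGroup A] [InnerProductSpace ℂ A] : Type _ :=
  UniformSpace.Completion (A ⊗[ℂ] A)

/-- A reproducing kernel Hilbert space is a reproducing kernel Hilbert algebra if it admits a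
bounded comultiplication `Δ : A → A ⊗ A` with `Δ k(x, ·) = k(x, ·) ⊗ k(x, ·)` for all `x`. -/
def IsRKHA : Prop :=
  ∃ D : A →L[ℂ] HilbertTensorSquare A, ∀ x : X,
    D (RKHS.kerFun A x 1) =
      ((RKHS.kerFun A x 1 ⊗ₜ[ℂ] RKHS.kerFun A x 1 : A ⊗[ℂ] A) : HilbertTensorSquare A)

/-- `A` is closed under pointwise multiplication. -/
def IsClosedUnderMul : Prop :=
  ∀ f g : A, ∃ h : A, ∀ x : X, h x = f x * g x

/-- `A` contains the constant function `1`. -/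
def ContainsOne : Prop :=
  ∃ e : A, ∀ x : X, e x = 1

end RKHA

end

/-! With Ψ(ξ) = (√λₙ ξ^{⊗n})ₙ in the ℓ² sum of tensor powers, ⟪Ψ ξ, Ψ η⟫ = Λ(⟪ξ, η⟫), so the kernel
is positive semidefinite (`exists_featureMap`). Every f factors as a bounded functional composed
with Ψ, and Ψ is a power series on the open ball; this gives holomorphy.

All other operators are prescribed on the kernel sections, whose span is dense, and extended by
comparing Gram kernels (`exists_clm_of_norm_le`). If C a - b has nonnegative coefficients, its
kernel is positive semidefinite, so vectors with Gram kernel b are controlled with constant √C by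
vectors with Gram kernel a (`norm_sum_le_of_wienerLE`). Taking b = Λ² gives the comultiplication,
whose adjoint is multiplication; b = 1 gives the unit. For a unitary the two Gram kernels coincide.
-/

/-! ### Tensor powers and the feature map -/

theorem exists_multilinearMap_inner_eq_prod (E : Type u) [NormedAddCommGroup E]
    [InnerProductSpace ℂ E] (n : ℕ) :
    ∃ (T : Type u) (_ : NormedAddCommGroup T) (_ : InnerProductSpace ℂ T)
      (m : MultilinearMap ℂ (fun _ : Fin n => E) T),
      ∀ v w, ⟪m v, m w⟫_ℂ = ∏ i, ⟪v i, w i⟫_ℂ := by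
  induction n with
  | zero =>
    -- A copy of ℂ in universe `u` serves as the empty tensor power.
    refine ⟨EuclideanSpace ℂ PUnit.{u + 1}, inferInstance, inferInstance,
      MultilinearMap.constOfIsEmpty ℂ _ (EuclideanSpace.single PUnit.unit (1 : ℂ)), fun v w => ?_⟩
    simp
  | succ n ih =>
    obtain ⟨T, _, _, m, hm⟩ := ih
    -- The next power is v₀ ⊗ m(v₁, …, vₙ), in the uncompleted tensor product.
    let L : E →ₗ[ℂ] MultilinearMap ℂ (fun _ : Fin n => E) (E ⊗[ℂ] T) :=
      { toFun := fun v => (TensorProduct.mk ℂ E T v).compMultilinearMap m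
        map_add' := fun v w => by ext x; simp
        map_smul' := fun c v => by ext x; simp [TensorProduct.smul_tmul'] }
    let M : MultilinearMap ℂ (fun _ : Fin (n + 1) => E) (E ⊗[ℂ] T) :=
      LinearMap.uncurryLeft (M := fun _ : Fin (n + 1) => E) L
    have hL : ∀ v, M v = v 0 ⊗ₜ[ℂ] m (Fin.tail v) := fun v => rfl
    refine ⟨E ⊗[ℂ] T, inferInstance, inferInstance, M, fun v w => ?_⟩
    rw [hL, hL, TensorProduct.inner_tmul, hm, Fin.prod_univ_succ]
    rfl

theorem WienerCone.coeff_eq {a : ℂ⟦X⟧} (ha : a ∈ WienerCone) (n : ℕ) :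
    PowerSeries.coeff n a = (‖PowerSeries.coeff n a‖ : ℂ) :=
  (Complex.eq_coe_norm_of_nonneg (ha.2 n))

theorem WienerAlgebra.summable_norm_eval {a : ℂ⟦X⟧} (ha : a ∈ WienerAlgebra) {z : ℂ}
    (hz : ‖z‖ ≤ 1) : Summable fun n => ‖PowerSeries.coeff n a * z ^ n‖ := by
  refine Summable.of_nonneg_of_le (fun _ => norm_nonneg _) (fun n => ?_) ha
  rw [norm_mul, norm_pow]
  exact mul_le_of_le_one_right (norm_nonneg _) (pow_le_one₀ (norm_nonneg _) hz)

/-- The kernel `a(⟪ξ, η⟫)` on the closed unit ball of an inner product space `E` has a feature map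
which is given by a power series on the open unit ball. -/
theorem exists_featureMap {E : Type u} [NormedAddCommGroup E] [InnerProductSpace ℂ E]
    {a : ℂ⟦X⟧} (ha : a ∈ WienerCone) :
    ∃ (F : Type u) (_ : NormedAddCommGroup F) (_ : InnerProductSpace ℂ F) (Ψ : E → F)
      (p : FormalMultilinearSeries ℂ E F),
      (∀ ξ η, ‖ξ‖ ≤ 1 → ‖η‖ ≤ 1 → ⟪Ψ ξ, Ψ η⟫_ℂ = wienerEval a ⟪ξ, η⟫_ℂ) ∧
      HasFPowerSeriesOnBall Ψ p 0 1 := by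
  choose T i1 i2 m hm using exists_multilinearMap_inner_eq_prod E
  have hnm : ∀ n v, ‖m n v‖ = ∏ i, ‖v i‖ := fun n v => by
    have h := hm n v v
    simp only [inner_self_eq_norm_sq_to_K, Finset.prod_pow] at h
    have h2 : ‖m n v‖ ^ 2 = (∏ i, ‖v i‖) ^ 2 := by exact_mod_cast h
    exact (sq_eq_sq₀ (norm_nonneg _) (Finset.prod_nonneg fun _ _ => norm_nonneg _)).1 h2
  let s : ℕ → ℝ := fun n => √‖PowerSeries.coeff n a‖
  have hs : ∀ n, s n ^ 2 = ‖PowerSeries.coeff n a‖ := fun n => Real.sq_sqrt (norm_nonneg _)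
  have hs0 : ∀ n, 0 ≤ s n := fun n => Real.sqrt_nonneg _
  have hnorm : ∀ ξ : E, ∀ n, ‖(s n : ℂ) • m n fun _ => ξ‖ = s n * ‖ξ‖ ^ n := fun ξ n => by
    rw [norm_smul, hnm, Complex.norm_real, Real.norm_of_nonneg (hs0 n)]
    simp
  have hmem : ∀ ξ : E, ‖ξ‖ ≤ 1 → Memℓp (fun n => (s n : ℂ) • m n fun _ => ξ) 2 := fun ξ hξ => by
    rw [memℓp_gen_iff (by norm_num)]
    refine Summable.of_nonneg_of_le (fun _ => by positivity) (fun n => ?_) ha.1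
    rw [hnorm]
    norm_num
    rw [mul_pow, hs]
    exact mul_le_of_le_one_right (norm_nonneg _)
      (pow_le_one₀ (by positivity) (pow_le_one₀ (norm_nonneg _) hξ))
  classical
  -- Square summability may fail outside the closed ball; the value 0 there is never used.
  let Ψ : E → lp T 2 := fun ξ => if h : ‖ξ‖ ≤ 1 then ⟨_, hmem ξ h⟩ else 0
  have hΨ : ∀ ξ, ‖ξ‖ ≤ 1 → ∀ n, Ψ ξ n = (s n : ℂ) • m n fun _ => ξ := fun ξ h n => by
    simp only [Ψ, dif_pos h]
  let p : FormalMultilinearSeries ℂ E (lp T 2) := fun n =>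
    MultilinearMap.mkContinuous
      ((s n : ℂ) • (lp.lsingle (𝕜 := ℂ) (E := T) 2 n).compMultilinearMap (m n)) (s n) fun v => by
        change ‖(s n : ℂ) • lp.single (E := T) 2 n (m n v)‖ ≤ _
        rw [norm_smul, lp.norm_single (by norm_num), hnm, Complex.norm_real,
          Real.norm_of_nonneg (hs0 n)]
  have hp : ∀ n (ξ : E), p n (fun _ => ξ) = lp.single (E := T) 2 n ((s n : ℂ) • m n fun _ => ξ) :=
    fun n ξ => (lp.single_smul (E := T) 2 n _ _).symm
  refine ⟨lp T 2, inferInstance, inferInstance, Ψ, p, fun ξ η hξ hη => ?_, ?_, one_pos, ?_⟩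
  · rw [lp.inner_eq_tsum, wienerEval]
    refine tsum_congr fun n => ?_
    rw [hΨ ξ hξ, hΨ η hη, inner_smul_left, inner_smul_right, hm, WienerCone.coeff_eq ha n, ← hs]
    simp
    ring
  -- The n-th term has norm at most √λₙ, which is bounded because λₙ ≤ ∑ λₖ; hence the radius is at
  -- least 1.
  · obtain ⟨C, hC⟩ : ∃ C, ∀ n, s n ≤ C := by
      refine ⟨√(∑' n, ‖PowerSeries.coeff n a‖), fun n => Real.sqrt_le_sqrt ?_⟩
      exact Summable.le_tsum ha.1 n fun _ _ => norm_nonneg _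
    refine p.le_radius_of_bound C (r := 1) fun n => ?_
    simp only [NNReal.coe_one, one_pow, mul_one]
    exact (MultilinearMap.mkContinuous_norm_le _ (hs0 n) _).trans (hC n)
  · intro ξ hξ
    have hξ' : ‖ξ‖ ≤ 1 := by
      rw [← ENNReal.ofReal_one, Metric.eball_ofReal, mem_ball_zero_iff] at hξ
      exact hξ.le
    rw [zero_add]
    have h := lp.hasSum_single (E := T) (p := 2) (by norm_num) (Ψ ξ)
    simp only [hΨ ξ hξ'] at h
    simpa only [hp] using h

/-! ### Gram sums and extension from a dense span -/

theorem norm_sq_finsupp_sum {X F : Type*} [NormedAddCommGroup F] [InnerProductSpace ℂ F]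
    (φ : X → F) (c : X →₀ ℂ) :
    ‖c.sum fun x z => z • φ x‖ ^ 2 =
      RCLike.re (c.sum fun x z => c.sum fun y w => star z * w * ⟪φ x, φ y⟫_ℂ) := by
  rw [← inner_self_eq_norm_sq (𝕜 := ℂ), Finsupp.sum_inner]
  congr 1
  refine Finsupp.sum_congr fun x _ => ?_
  rw [Finsupp.inner_sum]
  refine Finsupp.sum_congr fun y _ => ?_
  simp [inner_smul_left, inner_smul_right, mul_assoc, mul_left_comm]

/-- If the Gram kernel of `ψ` is dominated by a multiple of that of `k`, and `k` spans a dense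
subspace, then `k x ↦ ψ x` extends to a bounded operator. -/
theorem exists_clm_of_norm_le {X A F : Type*} [NormedAddCommGroup A] [NormedSpace ℂ A]
    [NormedAddCommGroup F] [NormedSpace ℂ F] [CompleteSpace F] {k : X → A}
    (hk : DenseRange (Finsupp.linearCombination ℂ k)) (ψ : X → F) (C : ℝ)
    (h : ∀ c : X →₀ ℂ, ‖c.sum fun x z => z • ψ x‖ ≤ C * ‖c.sum fun x z => z • k x‖) :
    ∃ D : A →L[ℂ] F, (∀ x, D (k x) = ψ x) ∧ ∀ f, ‖D f‖ ≤ C * ‖f‖ := by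
  refine ⟨(Finsupp.linearCombination ℂ ψ).extendOfNorm (Finsupp.linearCombination ℂ k),
    fun x => ?_, fun f => LinearMap.norm_extendOfNorm_apply_le hk C h f⟩
  have := LinearMap.extendOfNorm_eq hk (f := Finsupp.linearCombination ℂ ψ) ⟨C, h⟩ (Finsupp.single x 1)
  simpa using this

/-- Conjugating the coefficients swaps the arguments of the Gram kernel. This is needed because
kernel sections satisfy ⟪k_ξ, k_η⟫ = Λ(⟪η, ξ⟫), while ⟪Ψ ξ, Ψ η⟫ = Λ(⟪ξ, η⟫). -/
theorem norm_sq_finsupp_sum_star {X F : Type*} [NormedAddCommGroup F] [InnerProductSpace ℂ F]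
    (φ : X → F) (c : X →₀ ℂ) :
    ‖c.sum fun x z => star z • φ x‖ ^ 2 =
      RCLike.re (c.sum fun x z => c.sum fun y w => star z * w * ⟪φ y, φ x⟫_ℂ) := by
  rw [← inner_self_eq_norm_sq (𝕜 := ℂ)]
  simp only [Finsupp.sum, sum_inner, inner_sum]
  congr 1
  refine Finset.sum_congr rfl fun x _ => Finset.sum_congr rfl fun y _ => ?_
  simp [inner_smul_left, inner_smul_right, mul_left_comm, mul_assoc]

/-! ### Evaluation on the Wiener algebra -/

section Eval

variable {a b : ℂ⟦X⟧} {z : ℂ}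

theorem wienerEval_conj (ha : a ∈ WienerCone) (z : ℂ) :
    wienerEval a (star z) = star (wienerEval a z) := by
  simp only [wienerEval]
  rw [tsum_star]
  refine tsum_congr fun n => ?_
  rw [star_mul', star_pow, WienerCone.coeff_eq ha n]
  simp

theorem WienerAlgebra.smul_mem (C : ℂ) (ha : a ∈ WienerAlgebra) : C • a ∈ WienerAlgebra := by
  have h : Summable fun n => ‖PowerSeries.coeff n a‖ := ha
  simpa [WienerAlgebra, norm_mul] using h.mul_left ‖C‖

theorem wienerEval_smul (C : ℂ) (a : ℂ⟦X⟧) (z : ℂ) :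
    wienerEval (C • a) z = C * wienerEval a z := by
  simp [wienerEval, mul_assoc, tsum_mul_left]

theorem wienerEval_sub (ha : a ∈ WienerAlgebra) (hb : b ∈ WienerAlgebra) (hz : ‖z‖ ≤ 1) :
    wienerEval (a - b) z = wienerEval a z - wienerEval b z := by
  simp only [wienerEval, map_sub, sub_mul]
  exact ((WienerAlgebra.summable_norm_eval ha hz).of_norm).tsum_sub
    (WienerAlgebra.summable_norm_eval hb hz).of_norm

theorem WienerAlgebra.mul_mem (ha : a ∈ WienerAlgebra) (hb : b ∈ WienerAlgebra) :
    a * b ∈ WienerAlgebra := by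
  have h := summable_norm_sum_mul_antidiagonal_of_summable_norm (R := ℂ) ha hb
  simpa [WienerAlgebra, PowerSeries.coeff_mul] using h

theorem wienerEval_mul (ha : a ∈ WienerAlgebra) (hb : b ∈ WienerAlgebra) (hz : ‖z‖ ≤ 1) :
    wienerEval (a * b) z = wienerEval a z * wienerEval b z := by
  simp only [wienerEval]
  rw [tsum_mul_tsum_eq_tsum_sum_antidiagonal_of_summable_norm
    (WienerAlgebra.summable_norm_eval ha hz) (WienerAlgebra.summable_norm_eval hb hz)]
  refine tsum_congr fun n => ?_
  rw [PowerSeries.coeff_mul, Finset.sum_mul]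
  refine Finset.sum_congr rfl fun ij hij => ?_
  rw [← Finset.HasAntidiagonal.mem_antidiagonal.1 hij, pow_add]
  ring

theorem WienerAlgebra.one_mem : (1 : ℂ⟦X⟧) ∈ WienerAlgebra := by
  refine summable_of_ne_finset_zero (s := {0}) fun n hn => ?_
  simp only [Finset.mem_singleton] at hn
  simp [PowerSeries.coeff_one, hn]

theorem wienerEval_one (z : ℂ) : wienerEval 1 z = 1 := by
  rw [wienerEval, tsum_eq_single 0 fun n hn => by simp [PowerSeries.coeff_one, hn]]
  simp

/-- Dividing by λ₀ makes the constant coefficients cancel; the remaining ones are λₙ / λ₀ ≥ 0. -/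
theorem wienerLE_one (ha : a ∈ WienerCone) (h0 : PowerSeries.coeff 0 a ≠ 0) :
    WienerLE 1 (((‖PowerSeries.coeff 0 a‖⁻¹ : ℝ) : ℂ) • a) := by
  refine ⟨?_, fun n => ?_⟩
  · have h1 : Summable fun n => ‖PowerSeries.coeff n
        (((‖PowerSeries.coeff 0 a‖⁻¹ : ℝ) : ℂ) • a)‖ := WienerAlgebra.smul_mem _ ha.1
    have h2 : Summable fun n => ‖PowerSeries.coeff n (1 : ℂ⟦X⟧)‖ := WienerAlgebra.one_mem
    refine (h1.add h2).of_nonneg_of_le (fun _ => norm_nonneg _) fun n => ?_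
    rw [map_sub]
    exact norm_sub_le _ _
  · have hc : (‖PowerSeries.coeff 0 a‖ : ℂ) ≠ 0 := by simpa using h0
    rcases eq_or_ne n 0 with rfl | hn
    · rw [map_sub, PowerSeries.coeff_smul, WienerCone.coeff_eq ha 0]
      rw [PowerSeries.coeff_zero_one, Complex.norm_real, norm_norm, Complex.ofReal_inv, smul_eq_mul,
        inv_mul_cancel₀ hc, sub_self]
    · rw [map_sub, PowerSeries.coeff_smul, WienerCone.coeff_eq ha n, PowerSeries.coeff_one,
        if_neg hn, sub_zero, smul_eq_mul]
      exact_mod_cast mul_nonneg (inv_nonneg.2 (norm_nonneg _)) (norm_nonneg _)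

end Eval

/-! ### From the Wiener order to norm bounds -/

section Domination

variable {ι E : Type*} [NormedAddCommGroup E] [InnerProductSpace ℂ E] {a b : ℂ⟦X⟧}
  {u : ι → E}

theorem norm_inner_le_one (hu : ∀ i, ‖u i‖ ≤ 1) (i j : ι) : ‖⟪u i, u j⟫_ℂ‖ ≤ 1 :=
  (norm_inner_le_norm _ _).trans (mul_le_one₀ (hu i) (norm_nonneg _) (hu j))

theorem re_sum_wienerEval_nonneg (ha : a ∈ WienerCone) (hu : ∀ i, ‖u i‖ ≤ 1) (c : ι →₀ ℂ) :
    0 ≤ RCLike.re (c.sum fun x z => c.sum fun y w =>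
      star z * w * wienerEval a ⟪u y, u x⟫_ℂ) := by
  obtain ⟨F, _, _, Ψ, p, hΨ, -⟩ := exists_featureMap (E := E) ha
  have h := norm_sq_finsupp_sum_star (fun x => Ψ (u x)) c
  simp only [hΨ _ _ (hu _) (hu _)] at h
  rw [← h]
  positivity

theorem norm_sum_le_of_wienerLE {A F : Type*} [NormedAddCommGroup A] [InnerProductSpace ℂ A]
    [NormedAddCommGroup F] [InnerProductSpace ℂ F] (ha : a ∈ WienerAlgebra)
    (hb : b ∈ WienerAlgebra) (hu : ∀ i, ‖u i‖ ≤ 1) {φ : ι → A} {ψ : ι → F}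
    (hφ : ∀ x y, ⟪φ x, φ y⟫_ℂ = wienerEval a ⟪u y, u x⟫_ℂ)
    (hψ : ∀ x y, ⟪ψ x, ψ y⟫_ℂ = wienerEval b ⟪u y, u x⟫_ℂ) {C : ℝ}
    (hC : 0 ≤ C) (hab : WienerLE b ((C : ℂ) • a)) (c : ι →₀ ℂ) :
    ‖c.sum fun x z => z • ψ x‖ ≤ √C * ‖c.sum fun x z => z • φ x‖ := by
  refine le_of_sq_le_sq ?_ (by positivity)
  rw [mul_pow, Real.sq_sqrt hC, norm_sq_finsupp_sum, norm_sq_finsupp_sum]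
  -- By definition of the order, C a - b lies in the cone, so its quadratic form is nonnegative; it
  -- is C times one squared norm minus the other.
  have h := re_sum_wienerEval_nonneg hab hu c
  have h2 : ∀ x y, wienerEval ((C : ℂ) • a - b) ⟪u y, u x⟫_ℂ =
      C * wienerEval a ⟪u y, u x⟫_ℂ - wienerEval b ⟪u y, u x⟫_ℂ := fun x y => by
    rw [wienerEval_sub (WienerAlgebra.smul_mem _ ha) hb (norm_inner_le_one hu _ _),
      wienerEval_smul]
  have h3 : (c.sum fun x z => c.sum fun y w =>
      star z * w * wienerEval ((C : ℂ) • a - b) ⟪u y, u x⟫_ℂ) =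
      C * (c.sum fun x z => c.sum fun y w => star z * w * ⟪φ x, φ y⟫_ℂ) -
        c.sum fun x z => c.sum fun y w => star z * w * ⟪ψ x, ψ y⟫_ℂ := by
    simp only [Finsupp.sum, Finset.mul_sum, ← Finset.sum_sub_distrib, h2, hφ, hψ]
    refine Finset.sum_congr rfl fun x _ => Finset.sum_congr rfl fun y _ => ?_
    ring
  rw [h3, map_sub, sub_nonneg] at h
  simpa using h

end Domination

/-! ### Density of kernel sections -/

namespace RKHS

variable {X A : Type*} [NormedAddCommGroup A] [InnerProductSpace ℂ A] [CompleteSpace A]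
  [RKHS ℂ A X ℂ]

theorem inner_kerFun_one (x : X) (f : A) : ⟪kerFun A x 1, f⟫_ℂ = f x := by
  simp [kerFun_inner]

variable (A) in
theorem denseRange_linearCombination_kerFun :
    DenseRange (Finsupp.linearCombination ℂ fun x : X => kerFun A x 1) := by
  have h := kerFun_dense A
  have hs : Submodule.span ℂ {g | ∃ (x : X) (v : ℂ), kerFun A x v = g} ≤
      LinearMap.range (Finsupp.linearCombination ℂ fun x : X => kerFun A x 1) := by
    rw [Submodule.span_le]
    rintro _ ⟨x, v, rfl⟩
    refine ⟨Finsupp.single x v, ?_⟩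
    rw [Finsupp.linearCombination_single, ← map_smul, smul_eq_mul, mul_one]
  have h2 := top_le_iff.1 (h.symm.le.trans (Submodule.topologicalClosure_mono hs))
  have h3 := (Submodule.dense_iff_topologicalClosure_eq_top).2 h2
  rwa [LinearMap.coe_range] at h3

theorem clm_ext_kerFun {F : Type*} [NormedAddCommGroup F] [NormedSpace ℂ F] {S T : A →L[ℂ] F}
    (h : ∀ x : X, S (kerFun A x 1) = T (kerFun A x 1)) : S = T := by
  refine ContinuousLinearMap.ext fun f => ?_
  refine (denseRange_linearCombination_kerFun A).induction (P := fun f => S f = T f) ?_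
    (isClosed_eq S.continuous T.continuous) f
  rintro _ ⟨c, rfl⟩
  simp [Finsupp.linearCombination_apply, map_finsuppSum, h]

end RKHS

theorem IsEssential.exists_mul_wienerLE {a : ℂ⟦X⟧} (ha : IsEssential a) :
    ∃ C : ℝ, 0 ≤ C ∧ WienerLE (a * a) ((C : ℂ) • a) := by
  obtain ⟨-, C, hC, h⟩ := ha
  exact ⟨C, hC.le, by rwa [← sq]⟩

/-! ### The kernel on the Cameron–Martin ball -/

namespace CovarianceOperator

variable {H : Type*} [NormedAddCommGroup H] [InnerProductSpace ℂ H] [CompleteSpace H]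
  {K : CovarianceOperator H} {Λ : ℂ⟦X⟧}

theorem norm_coe_closedBall_le (ξ : K.closedBall) : ‖(ξ : K.CameronMartin)‖ ≤ 1 :=
  mem_closedBall_zero_iff.1 ξ.2

theorem star_kernelFun (hΛ : Λ ∈ WienerCone) (ξ η : K.closedBall) :
    star (K.kernelFun Λ ξ η) = K.kernelFun Λ η ξ := by
  rw [kernelFun, kernelFun, ← wienerEval_conj hΛ]
  congr 1
  exact inner_conj_symm _ _

theorem posSemidef_kernelMatrix (hΛ : Λ ∈ WienerCone) : (K.kernelMatrix Λ).PosSemidef := by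
  have htfae := (RKHS.posSemidef_tfae (K := K.kernelMatrix Λ)).out 0 2
  refine htfae.2 ⟨?_, fun c => ?_⟩
  · ext ξ η
    rw [Matrix.conjTranspose_apply]
    simp only [kernelMatrix, Matrix.of_apply, star_smul, star_kernelFun hΛ]
    have h1 : star (ContinuousLinearMap.id ℂ ℂ) = ContinuousLinearMap.id ℂ ℂ := star_one _
    rw [h1]
  · refine (re_sum_wienerEval_nonneg hΛ norm_coe_closedBall_le c).trans_eq ?_
    congr 1
    refine Finsupp.sum_congr fun ξ _ => Finsupp.sum_congr fun η _ => ?_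
    have h := star_kernelFun hΛ ξ η
    simp only [kernelFun] at h
    rw [← h]
    simp [kernelMatrix, kernelFun]
    ring

section RKHS

open RKHS

variable {A : Type*} [NormedAddCommGroup A] [InnerProductSpace ℂ A] [CompleteSpace A]
  [RKHS ℂ A K.closedBall ℂ]

theorem kerFun_one_apply (hA : RKHS.kernel A = K.kernelMatrix Λ) (ξ η : K.closedBall) :
    kerFun A ξ 1 η = K.kernelFun Λ ξ η := by
  rw [kerFun_apply, hA]
  simp [kernelMatrix]

theorem inner_kerFun_kerFun (hA : RKHS.kernel A = K.kernelMatrix Λ) (ξ η : K.closedBall) :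
    ⟪kerFun A ξ 1, kerFun A η 1⟫_ℂ =
      wienerEval Λ ⟪(η : K.CameronMartin), (ξ : K.CameronMartin)⟫_ℂ := by
  rw [inner_kerFun_one, kerFun_one_apply hA, kernelFun]

theorem exists_analyticOnNhd_openBall (hΛ : Λ ∈ WienerCone)
    (hA : RKHS.kernel A = K.kernelMatrix Λ) (f : A) :
    ∃ F : K.CameronMartin → ℂ, AnalyticOnNhd ℂ F K.openBall ∧
      ∀ ξ : K.closedBall, F ξ = f ξ := by
  obtain ⟨F, _, _, Ψ, p, hΨ, hp⟩ := exists_featureMap (E := K.CameronMartin) hΛ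
  have hΨ' := fun ξ η : K.closedBall =>
    hΨ ξ η (norm_coe_closedBall_le ξ) (norm_coe_closedBall_le η)
  -- V sends k_ξ to the functional ⟪Ψ ξ, ·⟫ isometrically. The dual is the target because it is
  -- complete even if the feature space is not, and because ξ ↦ ⟪Ψ ξ, ·⟫ has the swapped Gram kernel
  -- that matches the sections.
  obtain ⟨V, hV, -⟩ := exists_clm_of_norm_le (denseRange_linearCombination_kerFun A)
    (fun ξ : K.closedBall => innerSL ℂ (Ψ ξ)) 1 fun c => by
      have h : (c.sum fun (ξ : K.closedBall) z => z • innerSL ℂ (Ψ ξ)) =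
          innerSL ℂ (c.sum fun (ξ : K.closedBall) z => star z • Ψ ξ) := by
        simp [Finsupp.sum, map_sum, map_smulₛₗ]
      rw [h, innerSL_apply_norm, one_mul]
      refine le_of_sq_le_sq (le_of_eq ?_) (norm_nonneg _)
      rw [norm_sq_finsupp_sum_star (fun ξ : K.closedBall => Ψ ξ), norm_sq_finsupp_sum]
      simp only [hΨ', inner_kerFun_kerFun hA]
  refine ⟨fun ξ => V f (Ψ ξ), ?_, fun ξ => ?_⟩
  · have h := ((V f).comp_hasFPowerSeriesOnBall hp).analyticOnNhd
    rwa [← ENNReal.ofReal_one, Metric.eball_ofReal] at h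
  -- For fixed ξ, both f ↦ V f (Ψ ξ) and evaluation at ξ are bounded, so agreement on sections
  -- suffices.
  · have h : (V.flip (Ψ ξ) : A →L[ℂ] ℂ) = innerSL ℂ (kerFun A ξ 1) :=
      clm_ext_kerFun fun η => by
        rw [ContinuousLinearMap.flip_apply, hV, innerSL_apply_apply, innerSL_apply_apply,
          inner_kerFun_kerFun hA, hΨ']
    have h2 := congrArg (fun S : A →L[ℂ] ℂ => S f) h
    simpa only [ContinuousLinearMap.flip_apply, innerSL_apply_apply, inner_kerFun_one] using h2

theorem kernelFun_ballMap_symm (U : K.CameronMartin ≃ₗᵢ[ℂ] K.CameronMartin)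
    (ξ η : K.closedBall) :
    K.kernelFun Λ (K.ballMap U.symm ξ) η = K.kernelFun Λ ξ (K.ballMap U η) := by
  simp only [kernelFun, ballMap]
  rw [← U.inner_map_map, U.apply_symm_apply]

theorem exists_comp_unitary_norm_le (hA : RKHS.kernel A = K.kernelMatrix Λ)
    (U : K.CameronMartin ≃ₗᵢ[ℂ] K.CameronMartin) (f : A) :
    ∃ g : A, (∀ ξ : K.closedBall, g ξ = f (K.ballMap U ξ)) ∧ ‖g‖ ≤ ‖f‖ := by
  -- Composition with U sends k_ξ to k_{U⁻¹ξ}, and U⁻¹ preserves the Gram kernel, so the constant is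
  -- 1.
  obtain ⟨D, hD, hn⟩ := exists_clm_of_norm_le (denseRange_linearCombination_kerFun A)
    (fun ξ : K.closedBall => kerFun A (K.ballMap U.symm ξ) 1) 1 fun c => by
      rw [one_mul]
      refine le_of_sq_le_sq (le_of_eq ?_) (norm_nonneg _)
      rw [norm_sq_finsupp_sum, norm_sq_finsupp_sum]
      simp only [inner_kerFun_kerFun hA, ballMap, U.symm.inner_map_map]
  refine ⟨D f, fun ξ => ?_, by simpa using hn f⟩
  have h : innerSL ℂ (kerFun A ξ 1) ∘L D = innerSL ℂ (kerFun A (K.ballMap U ξ) 1) :=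
    clm_ext_kerFun fun η => by
      rw [ContinuousLinearMap.comp_apply, hD, innerSL_apply_apply, innerSL_apply_apply,
        inner_kerFun_one, inner_kerFun_one, kerFun_one_apply hA, kerFun_one_apply hA,
        kernelFun_ballMap_symm]
  have h2 := congrArg (fun S : A →L[ℂ] ℂ => S f) h
  simpa only [ContinuousLinearMap.comp_apply, innerSL_apply_apply, inner_kerFun_one] using h2

/-- The reverse inequality is the contraction bound for U⁻¹, which recovers f from f ∘ U. -/
theorem exists_comp_unitary (hA : RKHS.kernel A = K.kernelMatrix Λ)
    (U : K.CameronMartin ≃ₗᵢ[ℂ] K.CameronMartin) (f : A) :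
    ∃ g : A, (∀ ξ : K.closedBall, g ξ = f (K.ballMap U ξ)) ∧ ‖g‖ = ‖f‖ := by
  obtain ⟨g, hg, hgf⟩ := exists_comp_unitary_norm_le hA U f
  obtain ⟨f', hf', hfg⟩ := exists_comp_unitary_norm_le hA U.symm g
  have h : f' = f := RKHS.ext fun ξ => by
    rw [hf', hg]
    congr 1
    exact Subtype.ext (U.apply_symm_apply _)
  exact ⟨g, hg, le_antisymm hgf (h ▸ hfg)⟩

/-- The vectors k_ξ ⊗ k_ξ have Gram kernel Λ², which essentiality bounds by C Λ. -/
theorem isRKHA (hΛ : IsEssential Λ) (hA : RKHS.kernel A = K.kernelMatrix Λ) : IsRKHA A := by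
  obtain ⟨C, hC, hle⟩ := hΛ.exists_mul_wienerLE
  have ha := hΛ.1.1
  obtain ⟨D, hD, -⟩ := exists_clm_of_norm_le (denseRange_linearCombination_kerFun A)
    (fun ξ : K.closedBall =>
      ((kerFun A ξ 1 ⊗ₜ[ℂ] kerFun A ξ 1 : A ⊗[ℂ] A) : HilbertTensorSquare A)) (√C)
    (norm_sum_le_of_wienerLE ha (WienerAlgebra.mul_mem ha ha)
      norm_coe_closedBall_le (inner_kerFun_kerFun hA) (fun ξ η => by
        rw [UniformSpace.Completion.inner_coe, TensorProduct.inner_tmul, inner_kerFun_kerFun hA,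
          wienerEval_mul ha ha (norm_inner_le_one norm_coe_closedBall_le _ _)]) hC hle)
  exact ⟨D, hD⟩

theorem containsOne (hΛ : Λ ∈ WienerCone) (h0 : PowerSeries.coeff 0 Λ ≠ 0)
    (hA : RKHS.kernel A = K.kernelMatrix Λ) : ContainsOne A := by
  obtain ⟨D, hD, -⟩ := exists_clm_of_norm_le (denseRange_linearCombination_kerFun A)
    (fun _ : K.closedBall => (1 : ℂ)) (√(‖PowerSeries.coeff 0 Λ‖⁻¹))
    (norm_sum_le_of_wienerLE hΛ.1 WienerAlgebra.one_mem norm_coe_closedBall_le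
      (inner_kerFun_kerFun hA) (fun ξ η => by simp [wienerEval_one])
      (inv_nonneg.2 (norm_nonneg _)) (wienerLE_one hΛ h0))
  -- D takes the value 1 on every section, so its Riesz representative is the constant function 1.
  refine ⟨(InnerProductSpace.toDual ℂ A).symm D, fun ξ => ?_⟩
  rw [← inner_kerFun_one, ← inner_conj_symm, InnerProductSpace.toDual_symm_apply, hD, map_one]

end RKHS

end CovarianceOperator

/-- Multiplication on a reproducing kernel Hilbert algebra is the adjoint of the
comultiplication. -/
theorem IsRKHA.isClosedUnderMul {X A : Type*} [NormedAddCommGroup A] [InnerProductSpace ℂ A]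
    [CompleteSpace A] [RKHS ℂ A X ℂ] (hA : IsRKHA A) : IsClosedUnderMul A := by
  obtain ⟨D, hD⟩ := hA
  refine fun f g => ⟨D.adjoint ((f ⊗ₜ[ℂ] g : A ⊗[ℂ] A) : HilbertTensorSquare A), fun x => ?_⟩
  rw [← RKHS.inner_kerFun_one, ContinuousLinearMap.adjoint_inner_right, hD,
    UniformSpace.Completion.inner_coe, TensorProduct.inner_tmul, RKHS.inner_kerFun_one,
    RKHS.inner_kerFun_one]

/-- The properties depend only on the kernel, so they are stated for every space realising it; the
existence clause supplies one. On the cone, `coeff 0 Λ ≠ 0` means λ₀ > 0. -/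
theorem theorem1 {H : Type u} [NormedAddCommGroup H] [InnerProductSpace ℂ H] [CompleteSpace H]
    [TopologicalSpace.SeparableSpace H] (hH : ¬ FiniteDimensional ℂ H)
    (K : CovarianceOperator H) (Λ : ℂ⟦X⟧) (hΛ : Λ ∈ WienerCone) :
    (K.kernelMatrix Λ).PosSemidef ∧
    (∃ (A : Type u) (_ : NormedAddCommGroup A) (_ : InnerProductSpace ℂ A) (_ : CompleteSpace A)
      (_ : RKHS ℂ A K.closedBall ℂ), RKHS.kernel A = K.kernelMatrix Λ) ∧
    ∀ (A : Type*) [NormedAddCommGroup A] [InnerProductSpace ℂ A] [CompleteSpace A]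
      [RKHS ℂ A K.closedBall ℂ], RKHS.kernel A = K.kernelMatrix Λ →
      (∀ f : A, ∃ F : K.CameronMartin → ℂ, AnalyticOnNhd ℂ F K.openBall ∧
        ∀ ξ : K.closedBall, (ξ : K.CameronMartin) ∈ K.openBall → F ξ = f ξ) ∧
      (∀ (U : K.CameronMartin ≃ₗᵢ[ℂ] K.CameronMartin) (f : A),
        ∃ g : A, (∀ ξ : K.closedBall, g ξ = f (K.ballMap U ξ)) ∧ ‖g‖ = ‖f‖) ∧
      (IsEssential Λ → IsRKHA A ∧ IsClosedUnderMul A ∧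
        (PowerSeries.coeff 0 Λ ≠ 0 → ContainsOne A)) := by
  have hpos : (K.kernelMatrix Λ).PosSemidef := CovarianceOperator.posSemidef_kernelMatrix hΛ
  refine ⟨hpos, ?_, fun A _ _ _ _ hA => ⟨fun f => ?_, CovarianceOperator.exists_comp_unitary hA,
    fun he => ?_⟩⟩
  · have : Fact (K.kernelMatrix Λ).PosSemidef := ⟨hpos⟩
    exact ⟨RKHS.OfKernel (K.kernelMatrix Λ), inferInstance, inferInstance, inferInstance,
      inferInstance, RKHS.OfKernel.kernel_ofKernel⟩
  · obtain ⟨F, hF, h⟩ := CovarianceOperator.exists_analyticOnNhd_openBall hΛ hA f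
    exact ⟨F, hF, fun ξ _ => h ξ⟩
  · have hR : IsRKHA A := CovarianceOperator.isRKHA he hA
    exact ⟨hR, hR.isClosedUnderMul, fun h0 => CovarianceOperator.containsOne hΛ h0 hA⟩
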